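/- **Setting.** A signature $\Theta$ consists of a set of predicate letters of positive arities and a set of individual constants (no function symbols). A Kripke $\Theta$-model $\mathcal M=\langle W,\prec,\mathfrak A,\mathbb H\rangle$ consists of a non-empty set $W$ of worlds, a partial order $\prec$ on $W$, classical first-order $\Theta$-structures $\mathfrak A_w=(A_w,I_w)$ ($w\in W$) with non-empty, pairwise disjoint domains, and homomorphisms $\mathbb H_{wv}:\mathfrak A_w\to\mathfrak A_v$ for $w\prec v$ (preserving predicates and constants) with $\mathbb H_{ww}=\mathrm{id}$ and $\mathbb H_{wu}=\mathbb H_{vu}\circ\mathbb H_{wv}$ for $w\prec v\prec u$; put $\mathbb A=\bigcup_w A_w$. $In$ and $Su$ are the classes of models all of whose maps $\mathbb H_{wv}$ are injective, respectively surjective, and $Bi=In\cap Su$. Satisfaction $\mathcal M,w\models\varphi[\bar a]$ of first-order formulas (connectives $\bot,\wedge,\vee,\to$, quantifiers $\forall,\exists$) is Kripke satisfaction: $\mathcal M,w\models(\varphi\to\psi)[\bar a]$ iff for all $v\succ w$, $\mathcal M,v\models\varphi[\mathbb H_{wv}\bar a]$ implies $\mathcal M,v\models\psi[\mathbb H_{wv}\bar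 a]$; $\mathcal M,w\models\exists x\varphi$ iff some object of $A_w$ as value of $x$ satisfies $\varphi$ at $w$; $\mathcal M,w\models(\forall x\varphi)[\bar a]$ iff for all $v\succ w$ every object of $A_v$ as value of $x$ satisfies $\varphi[\mathbb H_{wv}\bar a]$ at $v$; $t\equiv s$ holds at $w$ iff $t$ and $s$ have the same value in $A_w$; the other clauses are the usual local ones. ($\prec$ is reflexive.) **Logics.** $StIL$ is the set of the six standard intuitionistic logics $\mathsf{IL},\mathsf{IL}^{\equiv},\mathsf{In}^{\equiv},\mathsf{CD},\mathsf{CD}^{\equiv},\mathsf{Bi}^{\equiv}$. Their sentences are the first-order sentences without equality ($\mathsf{IL},\mathsf{CD}$) or with equality (the other four), and their models are all Kripke models ($\mathsf{IL},\mathsf{IL}^{\equiv}$), those in $In$ ($\mathsf{In}^{\equiv}$), in $Su$ ($\mathsf{CD},\mathsf{CD}^{\equiv}$), in $Bi$ ($\mathsf{Bi}^{\equiv}$). $L(\Theta)$ is the set of $\Theta$-sentences of $\mathcal L$, and $Str_{\mathcal L}(\Theta)$ is the class of pairs $(\mathcal M,w)$ with $\mathcal M$ a $\Theta$-model of $\mathcal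 L$ and $w\in W$. **Types, elementary submodels.** For $w\in W$ and $\bar a_n\in A_w^n$ let $([\mathcal M,w],\bar c_n/\bar a_n)$ be the restriction of $\mathcal M$ to the worlds $v\succ w$, expanded by $n$ pairwise distinct fresh constants $\bar c_n$ which denote $\mathbb H_{wv}\langle\bar a_n\rangle$ at $v$. The type $Tp_{\mathcal L}(\mathcal M,w,\bar c_n/\bar a_n)$ is the pair of the set of sentences in $L(\Theta\cup\{\bar c_n\})$ true, and the set of those not true, at $w$ in this model. $\mathcal M$ is a submodel of $\mathcal N=\langle U,\lhd,\mathfrak B,\mathbb G\rangle$ if $W\subseteq U$, $\prec$ is the restriction of $\lhd$ to $W$, each $\mathfrak A_w$ is a substructure of $\mathfrak B_w$, and $\mathbb H_{wv}=\mathbb G_{wv}\upharpoonright A_w$ for $w\prec v$ in $W$. For models $\mathcal M,\mathcal N$ of $\mathcal L$, $\mathcal M\preccurlyeq_{\mathcal L}\mathcal N$ means that $\mathcal M$ is a submodel of $\mathcal N$ and $Tp_{\mathcal L}(\mathcal M,w,\bar c_n/\bar a_n)=Tp_{\mathcal L}(\mathcal N,w,\bar c_n/\bar a_n)$ for all $w\in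 W$, $n\ge 0$ and $\bar a_n\in A_w^n$. The union of a chain of models is formed componentwise. **Asimulations.** An $\mathcal L$-asimulation from $(\mathcal M_1,w_1)$ to $(\mathcal M_2,w_2)$ is a relation $A$ between pairs (world; tuple of objects) of the two models, that is, $A\subseteq\bigcup_{l\ge 0}\big(((W_1\times\mathbb A_1^l)\times(W_2\times\mathbb A_2^l))\cup((W_2\times\mathbb A_2^l)\times(W_1\times\mathbb A_1^l))\big)$ (the two models being taken as disjoint copies), such that $(w_1;\Lambda)\,A\,(w_2;\Lambda)$ for the empty tuple $\Lambda$ and, whenever $\{i,j\}=\{1,2\}$, $w\in W_i$, $v\in W_j$, $\bar\alpha_l\in(A_i)_w^l$, $\bar\beta_l\in(A_j)_v^l$ and $(w;\bar\alpha_l)\,A\,(v;\bar\beta_l)$: - every atomic sentence of $L(\Theta\cup\{\bar c_l\})$ true at $w$ in $([\mathcal M_i,w],\bar c_l/\bar\alpha_l)$ is true at $v$ in $([\mathcal M_j,v],\bar c_l/\bar\beta_l)$; - if $v\prec_j t$, then there is $u$ with $w\prec_i u$ such that $(u;(\mathbb H_i)_{wu}\langle\bar\alpha_l\rangle)\,A\,(t;(\mathbb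 H_j)_{vt}\langle\bar\beta_l\rangle)$ and $(t;(\mathbb H_j)_{vt}\langle\bar\beta_l\rangle)\,A\,(u;(\mathbb H_i)_{wu}\langle\bar\alpha_l\rangle)$; - for every $\alpha'\in(A_i)_w$ there is $\beta'\in(A_j)_v$ with $(w;\bar\alpha_l{}^\frown\alpha')\,A\,(v;\bar\beta_l{}^\frown\beta')$; - if $v\prec_j t$ and $\beta'\in(A_j)_t$, then there are $u$ with $w\prec_i u$ and $\alpha'\in(A_i)_u$ with $(u;(\mathbb H_i)_{wu}\langle\bar\alpha_l\rangle{}^\frown\alpha')\,A\,(t;(\mathbb H_j)_{vt}\langle\bar\beta_l\rangle{}^\frown\beta')$. **Lemma 4.1.** Every $\mathcal L\in StIL$ has the following three properties. 1. (Preservation under $\mathcal L$-asimulations.) For every signature $\Theta$ and all $(\mathcal M_1,w_1),(\mathcal M_2,w_2)\in Str_{\mathcal L}(\Theta)$, if there is an $\mathcal L$-asimulation from $(\mathcal M_1,w_1)$ to $(\mathcal M_2,w_2)$, then $\mathcal M_1,w_1\models\varphi$ implies $\mathcal M_2,w_2\models\varphi$ for every $\varphi\in L(\Theta)$. 2. ($\star$-compactness.)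 For every signature $\Theta$ and all $\Gamma,\Delta\subseteq L(\Theta)$: if for all finite $\Gamma'\subseteq\Gamma$ and $\Delta'\subseteq\Delta$ there is $(\mathcal M',w')\in Str_{\mathcal L}(\Theta)$ at which all sentences of $\Gamma'$ are true and no sentence of $\Delta'$ is true, then there is $(\mathcal M,w)\in Str_{\mathcal L}(\Theta)$ at which all sentences of $\Gamma$ are true and no sentence of $\Delta$ is true. 3. (Tarski Union Property.) For every signature $\Theta$ and every chain $\mathcal M_0\preccurlyeq_{\mathcal L}\mathcal M_1\preccurlyeq_{\mathcal L}\cdots$ of $\Theta$-models of $\mathcal L$ we have $\mathcal M_n\preccurlyeq_{\mathcal L}\bigcup_{k\in\omega}\mathcal M_k$ for all $n\in\omega$; in particular, the union is again a model of $\mathcal L$. -/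

import Mathlib

universe u

/-- A signature: predicate letters, each of positive arity, and individual constants
(no function symbols, no propositional letters). -/
structure Signature : Type (u + 1) where
  Pred : Type u
  arity : Pred → ℕ
  arity_pos : ∀ P, 0 < arity P
  Const : Type u

/-- The signature `Θ ∪ {c₁, …, cₙ}` with `n` pairwise distinct fresh constants; the constants of `Θ`
are `Sum.inl c` and the fresh ones are `Sum.inr i`. -/
def Signature.addConsts (Θ : Signature.{u}) (n : ℕ) : Signature.{u} where
  Pred := Θ.Pred
  arity := Θ.arity
  arity_pos := Θ.arity_pos
  Const := Θ.Const ⊕ Fin n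

/-- Terms: variables `v_i` (`i < ω`) and constants. -/
inductive FOTerm (Θ : Signature.{u}) : Type u where
  | var : ℕ → FOTerm Θ
  | const : Θ.Const → FOTerm Θ

/-- First-order formulas with equality. The formulas without equality are singled out by
`Formula.EqFree`. -/
inductive Formula (Θ : Signature.{u}) : Type u where
  | rel : (P : Θ.Pred) → (Fin (Θ.arity P) → FOTerm Θ) → Formula Θ
  | eq : FOTerm Θ → FOTerm Θ → Formula Θ
  | bot : Formula Θ
  | and : Formula Θ → Formula Θ → Formula Θ
  | or : Formula Θ → Formula Θ → Formula Θ
  | imp : Formula Θ → Formula Θ → Formula Θ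
  | all : ℕ → Formula Θ → Formula Θ
  | ex : ℕ → Formula Θ → Formula Θ

namespace Formula

/-- The set of (indices of) free variables. -/
def FV {Θ : Signature.{u}} : Formula Θ → Set ℕ
  | rel _ t => {x | ∃ i, t i = FOTerm.var x}
  | eq t s => {x | t = FOTerm.var x ∨ s = FOTerm.var x}
  | bot => ∅
  | and φ ψ => FV φ ∪ FV ψ
  | or φ ψ => FV φ ∪ FV ψ
  | imp φ ψ => FV φ ∪ FV ψ
  | all x φ => FV φ \ {x}
  | ex x φ => FV φ \ {x}

/-- The formula does not contain the equality symbol. -/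
def EqFree {Θ : Signature.{u}} : Formula Θ → Prop
  | rel _ _ => True
  | eq _ _ => False
  | bot => True
  | and φ ψ => EqFree φ ∧ EqFree ψ
  | or φ ψ => EqFree φ ∧ EqFree ψ
  | imp φ ψ => EqFree φ ∧ EqFree ψ
  | all _ φ => EqFree φ
  | ex _ φ => EqFree φ

/-- Atomic formulas `P(t₁, …, tₙ)` and `t ≡ s`. -/
def IsAtomic {Θ : Signature.{u}} : Formula Θ → Prop
  | rel _ _ => True
  | eq _ _ => True
  | _ => False

end Formula

/-- A first-order Kripke `Θ`-model. The worlds form a set inside the type `α` and all objects live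
in the type `δ`, so that inclusions and unions of models are literal ones. `const w c` matters only
for `w ∈ W`, and `map w v a` only for `w ≺ v` and `a ∈ A_w`. -/
structure KripkeModel (Θ : Signature.{u}) (α δ : Type u) : Type u where
  /-- the set `W` of worlds -/
  W : Set α
  W_nonempty : W.Nonempty
  /-- the partial order `≺ ⊆ W × W` -/
  le : α → α → Prop
  le_mem : ∀ {w v}, le w v → w ∈ W ∧ v ∈ W
  le_refl : ∀ {w}, w ∈ W → le w w
  le_trans : ∀ {w v u}, le w v → le v u → le w u
  le_antisymm : ∀ {w v}, le w v → le v w → w = v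
  /-- the domain `A_w` -/
  dom : α → Set δ
  dom_nonempty : ∀ {w}, w ∈ W → (dom w).Nonempty
  dom_disjoint : ∀ {w v}, w ∈ W → v ∈ W → w ≠ v → Disjoint (dom w) (dom v)
  /-- the interpretation `I_w(P) ⊆ A_w ^ n` -/
  rel : α → (P : Θ.Pred) → (Fin (Θ.arity P) → δ) → Prop
  rel_mem : ∀ {w P a}, w ∈ W → rel w P a → ∀ i, a i ∈ dom w
  /-- the interpretation `I_w(c) ∈ A_w` -/
  const : α → Θ.Const → δ
  const_mem : ∀ {w}, w ∈ W → ∀ c, const w c ∈ dom w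
  /-- the canonical homomorphism `ℍ_{wv} : A_w → A_v` for `w ≺ v` -/
  map : α → α → δ → δ
  map_mem : ∀ {w v a}, le w v → a ∈ dom w → map w v a ∈ dom v
  map_rel : ∀ {w v P a}, le w v → rel w P a → rel v P (fun i => map w v (a i))
  map_const : ∀ {w v}, le w v → ∀ c, map w v (const w c) = const v c
  map_refl : ∀ {w a}, w ∈ W → a ∈ dom w → map w w a = a
  map_trans : ∀ {w v u a}, le w v → le v u → a ∈ dom w → map w u a = map v u (map w v a)

namespace KripkeModel

variable {Θ : Signature.{u}} {α δ : Type u}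

/-- The domain `𝔸 = ⋃_{w ∈ W} A_w` of the model. -/
def domain (M : KripkeModel Θ α δ) : Set δ := ⋃ w ∈ M.W, M.dom w

/-- All canonical homomorphisms are injective (the class `In`). -/
def Inj (M : KripkeModel Θ α δ) : Prop :=
  ∀ w v, M.le w v → Set.InjOn (M.map w v) (M.dom w)

/-- All canonical homomorphisms are surjective (the class `Su`). -/
def Surj (M : KripkeModel Θ α δ) : Prop :=
  ∀ w v, M.le w v → Set.SurjOn (M.map w v) (M.dom w) (M.dom v)

/-- Value of a term at `w` under an assignment. -/
def termVal (M : KripkeModel Θ α δ) (w : α) (s : ℕ → δ) : FOTerm Θ → δ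
  | FOTerm.var x => s x
  | FOTerm.const c => M.const w c

/-- Kripke satisfaction `M, w ⊨ φ[s]`. -/
def Sat (M : KripkeModel Θ α δ) : α → Formula Θ → (ℕ → δ) → Prop
  | w, Formula.rel P t, s => M.rel w P (fun i => M.termVal w s (t i))
  | w, Formula.eq t t', s => M.termVal w s t = M.termVal w s t'
  | _, Formula.bot, _ => False
  | w, Formula.and φ ψ, s => Sat M w φ s ∧ Sat M w ψ s
  | w, Formula.or φ ψ, s => Sat M w φ s ∨ Sat M w ψ s
  | w, Formula.imp φ ψ, s =>
      ∀ v, M.le w v → Sat M v φ (fun x => M.map w v (s x)) →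
        Sat M v ψ (fun x => M.map w v (s x))
  | w, Formula.all x φ, s =>
      ∀ v, M.le w v → ∀ a ∈ M.dom v, Sat M v φ (Function.update (fun y => M.map w v (s y)) x a)
  | w, Formula.ex x φ, s => ∃ a ∈ M.dom w, Sat M w φ (Function.update s x a)

/-- `M, w ⊨ φ` for a sentence `φ`. Domains of worlds are nonempty and the truth of a sentence does
not depend on the assignment, so this says the same with some assignment in place of all. -/
def Models (M : KripkeModel Θ α δ) (w : α) (φ : Formula Θ) : Prop :=
  ∀ s : ℕ → δ, (∀ x, s x ∈ M.dom w) → M.Sat w φ s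

/-- `M` is a submodel of `N`. -/
structure Submodel (M N : KripkeModel Θ α δ) : Prop where
  worlds : M.W ⊆ N.W
  le_iff : ∀ {w v}, w ∈ M.W → v ∈ M.W → (M.le w v ↔ N.le w v)
  dom_subset : ∀ {w}, w ∈ M.W → M.dom w ⊆ N.dom w
  rel_iff : ∀ {w P a}, w ∈ M.W → (∀ i, a i ∈ M.dom w) → (M.rel w P a ↔ N.rel w P a)
  const_eq : ∀ {w}, w ∈ M.W → ∀ c, M.const w c = N.const w c
  map_eq : ∀ {w v a}, M.le w v → a ∈ M.dom w → M.map w v a = N.map w v a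

/-- The generated submodel `[M, w]`, with the worlds `{v | w ≺ v}`. -/
def gen (M : KripkeModel Θ α δ) (w : α) (hw : w ∈ M.W) : KripkeModel Θ α δ where
  W := {v | M.le w v}
  W_nonempty := ⟨w, M.le_refl hw⟩
  le v u := M.le w v ∧ M.le v u
  le_mem h := ⟨h.1, M.le_trans h.1 h.2⟩
  le_refl h := ⟨h, M.le_refl (M.le_mem h).2⟩
  le_trans h h' := ⟨h.1, M.le_trans h.2 h'.2⟩
  le_antisymm h h' := M.le_antisymm h.2 h'.2
  dom := M.dom
  dom_nonempty h := M.dom_nonempty (M.le_mem h).2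
  dom_disjoint h h' := M.dom_disjoint (M.le_mem h).2 (M.le_mem h').2
  rel := M.rel
  rel_mem h := M.rel_mem (M.le_mem h).2
  const := M.const
  const_mem h := M.const_mem (M.le_mem h).2
  map := M.map
  map_mem h := M.map_mem h.2
  map_rel h := M.map_rel h.2
  map_const h := M.map_const h.2
  map_refl h := M.map_refl (M.le_mem h).2
  map_trans h h' := M.map_trans h.2 h'.2

/-- The expansion `(M, c̄ₙ/āₙ)` of a model rooted at `w` by `n` fresh constants denoting the objects
`āₙ` of `A_w` at `w`, and hence `ℍ_{wv}⟨āₙ⟩` at `v`. -/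
def expand (M : KripkeModel Θ α δ) (w : α) (root : ∀ v ∈ M.W, M.le w v) {n : ℕ} (a : Fin n → δ)
    (ha : ∀ i, a i ∈ M.dom w) : KripkeModel (Θ.addConsts n) α δ where
  W := M.W
  W_nonempty := M.W_nonempty
  le := M.le
  le_mem := M.le_mem
  le_refl := M.le_refl
  le_trans := M.le_trans
  le_antisymm := M.le_antisymm
  dom := M.dom
  dom_nonempty := M.dom_nonempty
  dom_disjoint := M.dom_disjoint
  rel := M.rel
  rel_mem {_ P _} h := M.rel_mem (P := P) h
  const v := Sum.elim (M.const v) (fun i => M.map w v (a i))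
  const_mem {v} hv c := by
    cases c with
    | inl c => exact M.const_mem hv c
    | inr i => exact M.map_mem (root v hv) (ha i)
  map := M.map
  map_mem := M.map_mem
  map_rel {_ _ P _} h := M.map_rel (P := P) h
  map_const {v v'} h c := by
    cases c with
    | inl c => exact M.map_const h c
    | inr i => exact (M.map_trans (root v (M.le_mem h).1) h (ha i)).symm
  map_refl := M.map_refl
  map_trans := M.map_trans

/-- The model `([M, w], c̄ₙ/āₙ)`. -/
def genExpand (M : KripkeModel Θ α δ) (w : α) (hw : w ∈ M.W) {n : ℕ} (a : Fin n → δ)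
    (ha : ∀ i, a i ∈ M.dom w) : KripkeModel (Θ.addConsts n) α δ :=
  (M.gen w hw).expand w (fun _ hv => ⟨M.le_refl hw, hv⟩) a ha

/-! Unions of countable chains of models -/

theorem Submodel.refl (M : KripkeModel Θ α δ) : M.Submodel M :=
  ⟨fun _ h => h, fun _ _ => Iff.rfl, fun _ _ h => h, fun _ _ => Iff.rfl, fun _ _ => rfl,
    fun _ _ => rfl⟩

theorem Submodel.trans {M N K : KripkeModel Θ α δ} (h : M.Submodel N) (h' : N.Submodel K) :
    M.Submodel K where
  worlds := h.worlds.trans h'.worlds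
  le_iff hw hv := (h.le_iff hw hv).trans (h'.le_iff (h.worlds hw) (h.worlds hv))
  dom_subset hw := (h.dom_subset hw).trans (h'.dom_subset (h.worlds hw))
  rel_iff hw ha := (h.rel_iff hw ha).trans
    (h'.rel_iff (h.worlds hw) (fun i => h.dom_subset hw (ha i)))
  const_eq hw c := (h.const_eq hw c).trans (h'.const_eq (h.worlds hw) c)
  map_eq hwv ha := (h.map_eq hwv ha).trans
    (h'.map_eq ((h.le_iff (M.le_mem hwv).1 (M.le_mem hwv).2).1 hwv)
      (h.dom_subset (M.le_mem hwv).1 ha))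

theorem Submodel.le_of_le {M N : KripkeModel Θ α δ} (h : M.Submodel N) {w v : α}
    (hwv : M.le w v) : N.le w v :=
  (h.le_iff (M.le_mem hwv).1 (M.le_mem hwv).2).1 hwv

theorem chain_le {M : ℕ → KripkeModel Θ α δ} (hM : ∀ n, (M n).Submodel (M (n + 1)))
    {m n : ℕ} (hmn : m ≤ n) : (M m).Submodel (M n) := by
  induction hmn with
  | refl => exact Submodel.refl _
  | step _ ih => exact ih.trans (hM _)

open Classical in
/-- Constants in the union of a chain: the common value of the `I_w(c)`. -/
noncomputable def chainConst (M : ℕ → KripkeModel Θ α δ) (w : α) (c : Θ.Const) : δ :=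
  if h : ∃ n, w ∈ (M n).W then (M h.choose).const w c else (M 0).const w c

open Classical in
/-- Canonical maps in the union of a chain: the common value of the `ℍ_{wv}(a)`. -/
noncomputable def chainMap (M : ℕ → KripkeModel Θ α δ) (w v : α) (a : δ) : δ :=
  if h : ∃ n, (M n).le w v ∧ a ∈ (M n).dom w then (M h.choose).map w v a else a

theorem chainConst_eq {M : ℕ → KripkeModel Θ α δ} (hM : ∀ n, (M n).Submodel (M (n + 1)))
    {n : ℕ} {w : α} (hw : w ∈ (M n).W) (c : Θ.Const) : chainConst M w c = (M n).const w c := by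
  have h : ∃ n, w ∈ (M n).W := ⟨n, hw⟩
  rw [chainConst, dif_pos h]
  rw [(chain_le hM (le_max_left h.choose n)).const_eq h.choose_spec,
    (chain_le hM (le_max_right h.choose n)).const_eq hw]

theorem chainMap_eq {M : ℕ → KripkeModel Θ α δ} (hM : ∀ n, (M n).Submodel (M (n + 1)))
    {n : ℕ} {w v : α} {a : δ} (hwv : (M n).le w v) (ha : a ∈ (M n).dom w) :
    chainMap M w v a = (M n).map w v a := by
  have h : ∃ n, (M n).le w v ∧ a ∈ (M n).dom w := ⟨n, hwv, ha⟩
  rw [chainMap, dif_pos h]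
  rw [(chain_le hM (le_max_left h.choose n)).map_eq h.choose_spec.1 h.choose_spec.2,
    (chain_le hM (le_max_right h.choose n)).map_eq hwv ha]

/-- The union `⋃ₙ Mₙ` of a countable chain `M₀ ⊆ M₁ ⊆ …` of models. -/
noncomputable def chainUnion (M : ℕ → KripkeModel Θ α δ)
    (hM : ∀ n, (M n).Submodel (M (n + 1))) : KripkeModel Θ α δ where
  W := {w | ∃ n, w ∈ (M n).W}
  W_nonempty := ⟨(M 0).W_nonempty.some, 0, (M 0).W_nonempty.some_mem⟩
  le w v := ∃ n, (M n).le w v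
  le_mem := fun ⟨n, h⟩ => ⟨⟨n, ((M n).le_mem h).1⟩, ⟨n, ((M n).le_mem h).2⟩⟩
  le_refl := fun ⟨n, h⟩ => ⟨n, (M n).le_refl h⟩
  le_trans := fun ⟨m, h⟩ ⟨n, h'⟩ => ⟨max m n,
    (M _).le_trans ((chain_le hM (le_max_left m n)).le_of_le h)
      ((chain_le hM (le_max_right m n)).le_of_le h')⟩
  le_antisymm := fun ⟨m, h⟩ ⟨n, h'⟩ =>
    (M (max m n)).le_antisymm ((chain_le hM (le_max_left m n)).le_of_le h)
      ((chain_le hM (le_max_right m n)).le_of_le h')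
  dom w := {a | ∃ n, w ∈ (M n).W ∧ a ∈ (M n).dom w}
  dom_nonempty := fun ⟨n, h⟩ => ⟨((M n).dom_nonempty h).some, n, h, ((M n).dom_nonempty h).some_mem⟩
  dom_disjoint := by
    intro w v _ _ hne
    rw [Set.disjoint_left]
    rintro a ⟨m, hw, ha⟩ ⟨n, hv, ha'⟩
    have h1 := chain_le hM (le_max_left m n)
    have h2 := chain_le hM (le_max_right m n)
    exact Set.disjoint_left.1 ((M (max m n)).dom_disjoint (h1.worlds hw) (h2.worlds hv) hne)
      (h1.dom_subset hw ha) (h2.dom_subset hv ha')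
  rel w P a := ∃ n, w ∈ (M n).W ∧ (M n).rel w P a
  rel_mem := fun _ ⟨n, hw, h⟩ i => ⟨n, hw, (M n).rel_mem hw h i⟩
  const := chainConst M
  const_mem := fun ⟨n, hw⟩ c => by
    rw [chainConst_eq hM hw]
    exact ⟨n, hw, (M n).const_mem hw c⟩
  map := chainMap M
  map_mem := by
    rintro w v a ⟨m, h⟩ ⟨n, hw, ha⟩
    have h1 := (chain_le hM (le_max_left m n)).le_of_le h
    have h2 := (chain_le hM (le_max_right m n)).dom_subset hw ha
    rw [chainMap_eq hM h1 h2]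
    exact ⟨max m n, ((M _).le_mem h1).2, (M _).map_mem h1 h2⟩
  map_rel := by
    rintro w v P a ⟨m, h⟩ ⟨n, hw, ha⟩
    have h1 := (chain_le hM (le_max_left m n)).le_of_le h
    have hs := chain_le hM (le_max_right m n)
    have h2 : ∀ i, a i ∈ (M (max m n)).dom w :=
      fun i => hs.dom_subset hw ((M n).rel_mem hw ha i)
    have h3 := (hs.rel_iff hw ((M n).rel_mem hw ha)).1 ha
    refine ⟨max m n, ((M _).le_mem h1).2, ?_⟩
    have := (M (max m n)).map_rel h1 h3
    simpa only [chainMap_eq hM h1 (h2 _)] using this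
  map_const := by
    rintro w v ⟨n, h⟩ c
    have hw := ((M n).le_mem h).1
    rw [chainConst_eq hM hw, chainConst_eq hM ((M n).le_mem h).2,
      chainMap_eq hM h ((M n).const_mem hw c), (M n).map_const h]
  map_refl := by
    rintro w a _ ⟨n, hw, ha⟩
    rw [chainMap_eq hM ((M n).le_refl hw) ha, (M n).map_refl hw ha]
  map_trans := by
    rintro w v u a ⟨m, h⟩ ⟨k, h'⟩ ⟨n, hw, ha⟩
    set N := max (max m k) n with hN
    have h1 := (chain_le hM (show m ≤ N by omega)).le_of_le h
    have h2 := (chain_le hM (show k ≤ N by omega)).le_of_le h'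
    have h3 := (chain_le hM (show n ≤ N by omega)).dom_subset hw ha
    rw [chainMap_eq hM h1 h3, chainMap_eq hM h2 ((M N).map_mem h1 h3),
      chainMap_eq hM ((M N).le_trans h1 h2) h3, (M N).map_trans h1 h2 h3]

end KripkeModel

/-- The six standard intuitionistic logics `IL`, `IL^≡`, `In^≡`, `CD`, `CD^≡`, `Bi^≡`. -/
inductive StIL : Type where
  | IL
  | ILeq
  | Ineq
  | CD
  | CDeq
  | Bieq

namespace StIL

/-- The language of the logic contains the equality symbol. -/
def HasEq : StIL → Prop
  | IL => False
  | ILeq => True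
  | Ineq => True
  | CD => False
  | CDeq => True
  | Bieq => True

/-- The class of models of the logic: all models for `IL` and `IL^≡`, `In` for `In^≡`, `Su` for `CD`
and `CD^≡`, and `Bi = In ∩ Su` for `Bi^≡`. -/
def Admits (L : StIL) {Θ : Signature.{u}} {α δ : Type u} (M : KripkeModel Θ α δ) : Prop :=
  match L with
  | IL => True
  | ILeq => True
  | Ineq => M.Inj
  | CD => M.Surj
  | CDeq => M.Surj
  | Bieq => M.Inj ∧ M.Surj

/-- `(M, w) ∈ Str_L(Θ)`. -/
def Str (L : StIL) {Θ : Signature.{u}} {α δ : Type u} (M : KripkeModel Θ α δ) (w : α) : Prop :=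
  w ∈ M.W ∧ L.Admits M

/-- The set `L(Θ)` of sentences. -/
def sentences (L : StIL) (Θ : Signature.{u}) : Set (Formula Θ) :=
  {φ | φ.FV = ∅ ∧ (L.HasEq ∨ φ.EqFree)}

/-- The complete theory `Th_L(M, w)`, as the pair of its positive and its negative part. -/
def Th (L : StIL) {Θ : Signature.{u}} {α δ : Type u} (M : KripkeModel Θ α δ) (w : α) :
    Set (Formula Θ) × Set (Formula Θ) :=
  ({φ ∈ L.sentences Θ | M.Models w φ}, {φ ∈ L.sentences Θ | ¬ M.Models w φ})

/-- The complete type `Tp_L(M, w, c̄ₙ/āₙ) = Th_L(([M, w], c̄ₙ/āₙ), w)`. -/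
def Tp (L : StIL) {Θ : Signature.{u}} {α δ : Type u} (M : KripkeModel Θ α δ) (w : α)
    (hw : w ∈ M.W) {n : ℕ} (a : Fin n → δ) (ha : ∀ i, a i ∈ M.dom w) :
    Set (Formula (Θ.addConsts n)) × Set (Formula (Θ.addConsts n)) :=
  L.Th (M.genExpand w hw a ha) w

/-- `M ≼_L N`: `M` is an `L`-elementary submodel of `N` (both being models of `L`). -/
structure ElemSub (L : StIL) {Θ : Signature.{u}} {α δ : Type u} (M N : KripkeModel Θ α δ) :
    Prop where
  admits_left : L.Admits M
  admits_right : L.Admits N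
  sub : M.Submodel N
  tp_eq : ∀ (w : α) (hw : w ∈ M.W) (n : ℕ) (a : Fin n → δ) (ha : ∀ i, a i ∈ M.dom w),
    L.Tp M w hw a ha = L.Tp N w (sub.worlds hw) a (fun i => sub.dom_subset hw (ha i))

/-- The clauses imposed on an asimulation for one of the two orderings of the models: `R` is the
part of the asimulation that leads from `M` to `N`, and `S` the part that leads from `N` to `M`;
`R l w ᾱ v β̄` stands for `(w; ᾱ_l) A (v; β̄_l)`. -/
structure AsimClauses (L : StIL) {Θ : Signature.{u}} {α₁ δ₁ α₂ δ₂ : Type u}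
    (M : KripkeModel Θ α₁ δ₁) (N : KripkeModel Θ α₂ δ₂)
    (R : (l : ℕ) → α₁ → (Fin l → δ₁) → α₂ → (Fin l → δ₂) → Prop)
    (S : (l : ℕ) → α₂ → (Fin l → δ₂) → α₁ → (Fin l → δ₁) → Prop) : Prop where
  type : ∀ l w a v b, R l w a v b →
    (w ∈ M.W ∧ ∀ i, a i ∈ M.domain) ∧ (v ∈ N.W ∧ ∀ i, b i ∈ N.domain)
  atom : ∀ l w a v b (hw : w ∈ M.W) (ha : ∀ i, a i ∈ M.dom w) (hv : v ∈ N.W)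
    (hb : ∀ i, b i ∈ N.dom v), R l w a v b →
      ∀ φ ∈ L.sentences (Θ.addConsts l), φ.IsAtomic →
        (M.genExpand w hw a ha).Models w φ → (N.genExpand v hv b hb).Models v φ
  s_back : ∀ l w a v b t, w ∈ M.W → (∀ i, a i ∈ M.dom w) → (∀ i, b i ∈ N.dom v) →
    R l w a v b → N.le v t →
      ∃ u, M.le w u ∧ R l u (fun i => M.map w u (a i)) t (fun i => N.map v t (b i)) ∧
        S l t (fun i => N.map v t (b i)) u (fun i => M.map w u (a i))
  obj_forth : ∀ l w a v b a', w ∈ M.W → v ∈ N.W → (∀ i, a i ∈ M.dom w) → (∀ i, b i ∈ N.dom v) →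
    R l w a v b → a' ∈ M.dom w →
      ∃ b' ∈ N.dom v, R (l + 1) w (Fin.snoc a a') v (Fin.snoc b b')
  obj_back : ∀ l w a v b t b', w ∈ M.W → (∀ i, a i ∈ M.dom w) → (∀ i, b i ∈ N.dom v) →
    R l w a v b → N.le v t → b' ∈ N.dom t →
      ∃ u a', M.le w u ∧ a' ∈ M.dom u ∧
        R (l + 1) u (Fin.snoc (fun i => M.map w u (a i)) a') t
          (Fin.snoc (fun i => N.map v t (b i)) b')

/-- The relation with the two parts `R` (from `M₁` to `M₂`) and `S` (from `M₂` to `M₁`) is an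
`L`-asimulation from `(M₁, w₁, āₙ)` to `(M₂, w₂, b̄ₙ)`. -/
structure IsAsimulation (L : StIL) {Θ : Signature.{u}} {α₁ δ₁ α₂ δ₂ : Type u}
    (M₁ : KripkeModel Θ α₁ δ₁) (w₁ : α₁) (M₂ : KripkeModel Θ α₂ δ₂) (w₂ : α₂)
    {n : ℕ} (a : Fin n → δ₁) (b : Fin n → δ₂)
    (R : (l : ℕ) → α₁ → (Fin l → δ₁) → α₂ → (Fin l → δ₂) → Prop)
    (S : (l : ℕ) → α₂ → (Fin l → δ₂) → α₁ → (Fin l → δ₁) → Prop) : Prop where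
  elem : R n w₁ a w₂ b
  clauses_forward : L.AsimClauses M₁ M₂ R S
  clauses_backward : L.AsimClauses M₂ M₁ S R

/-- `L` is preserved under `L`-asimulations. -/
def PreservedUnderAsimulations (L : StIL) : Prop :=
  ∀ (Θ : Signature.{u}) (α₁ δ₁ α₂ δ₂ : Type u)
    (M₁ : KripkeModel Θ α₁ δ₁) (w₁ : α₁) (M₂ : KripkeModel Θ α₂ δ₂) (w₂ : α₂)
    (R : (l : ℕ) → α₁ → (Fin l → δ₁) → α₂ → (Fin l → δ₂) → Prop)
    (S : (l : ℕ) → α₂ → (Fin l → δ₂) → α₁ → (Fin l → δ₁) → Prop),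
    L.Str M₁ w₁ → L.Str M₂ w₂ →
    L.IsAsimulation M₁ w₁ M₂ w₂ (Fin.elim0 : Fin 0 → δ₁) (Fin.elim0 : Fin 0 → δ₂) R S →
    ∀ φ ∈ L.sentences Θ, M₁.Models w₁ φ → M₂.Models w₂ φ

/-- Some `(M, w) ∈ Str_L(Θ)` satisfies all of `Γ` and falsifies all of `Δ`. -/
def PairSatisfiable (L : StIL) {Θ : Signature.{u}} (Γ Δ : Set (Formula Θ)) : Prop :=
  ∃ (α δ : Type u) (M : KripkeModel Θ α δ) (w : α), L.Str M w ∧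
    (∀ φ ∈ Γ, M.Models w φ) ∧ ∀ φ ∈ Δ, ¬ M.Models w φ

/-- `L` is `⋆`-compact. -/
def StarCompact (L : StIL) : Prop :=
  ∀ (Θ : Signature.{u}) (Γ Δ : Set (Formula Θ)), Γ ⊆ L.sentences Θ → Δ ⊆ L.sentences Θ →
    (∀ Γ' ⊆ Γ, Γ'.Finite → ∀ Δ' ⊆ Δ, Δ'.Finite → L.PairSatisfiable Γ' Δ') →
    L.PairSatisfiable Γ Δ

/-- `L` has the Tarski Union Property. -/
def TarskiUnionProperty (L : StIL) : Prop :=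
  ∀ (Θ : Signature.{u}) (α δ : Type u) (M : ℕ → KripkeModel Θ α δ)
    (hM : ∀ n, L.ElemSub (M n) (M (n + 1))),
    ∀ n, L.ElemSub (M n) (KripkeModel.chainUnion M (fun k => (hM k).sub))

end StIL

/-! ### Coincidence -/

/-! Each property reduces to an induction on formulas evaluated under assignments. The definitions
of asimulation and type instead speak of sentences with fresh constants for a tuple. `sat_close` and
`sat_unclose` translate between the two views, because the constant for an object denotes at each
later world the image of that object under the canonical map.

Preservation: `AsimClauses.sat` shows that truth passes along related pairs as long as every free
variable takes its two values at a common position of the two tuples. An implication needs truth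
carried both ways, which the world clause provides by relating the new pair in both directions.

Compactness: ultraproducts of Kripke models, with worlds, order, objects and maps all taken modulo
the ultrafilter, satisfy Łoś's theorem (`ultraproduct_sat`). Injectivity and surjectivity of the
maps pass to the ultraproduct, so it stays in the class of the logic. Negation commutes with an
ultrafilter, hence falsity of the sentences in `Δ` is controlled just as truth of those in `Γ`.

Unions: the Tarski–Vaught argument (`sat_chainUnion_iff`). Finitely many worlds and objects of the
union already occur together at one stage, and elementarity of the chain moves the whole formula to
that stage and back. -/

theorem Formula.exists_FV_lt {Θ : Signature.{u}} (φ : Formula Θ) : ∃ n, ∀ x ∈ φ.FV, x < n := by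
  have h : φ.FV.Finite := by
    induction φ with
    | rel P t =>
      have hsub : (Formula.rel P t).FV ⊆
          ⋃ i, {x | t i = FOTerm.var x} := fun x ⟨i, hi⟩ => Set.mem_iUnion.2 ⟨i, hi⟩
      refine (Set.finite_iUnion fun i => ?_).subset hsub
      exact Set.Subsingleton.finite fun x hx y hy => by
        simpa using (show t i = _ from hx).symm.trans hy
    | eq t t' =>
      have hs : ∀ t : FOTerm Θ, {x | t = FOTerm.var x}.Finite := fun t =>
        Set.Subsingleton.finite fun x hx y hy => by
          simpa using (show t = _ from hx).symm.trans hy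
      exact (hs t).union (hs t')
    | bot => exact Set.finite_empty
    | and φ ψ h h' => exact h.union h'
    | or φ ψ h h' => exact h.union h'
    | imp φ ψ h h' => exact h.union h'
    | all x φ h => exact h.sdiff
    | ex x φ h => exact h.sdiff
  obtain ⟨n, hn⟩ := h.bddAbove
  exact ⟨n + 1, fun x hx => Nat.lt_succ_of_le (hn hx)⟩

namespace KripkeModel

variable {Θ : Signature.{u}} {α δ : Type u}

theorem sat_congr (M : KripkeModel Θ α δ) (φ : Formula Θ) {w : α} {s s' : ℕ → δ}
    (h : ∀ x ∈ φ.FV, s x = s' x) : M.Sat w φ s ↔ M.Sat w φ s' := by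
  have term : ∀ (w : α) (s s' : ℕ → δ) (t : FOTerm Θ), (∀ x, t = FOTerm.var x → s x = s' x) →
      M.termVal w s t = M.termVal w s' t := by
    intro w s s' t ht
    cases t with
    | var x => exact ht x rfl
    | const c => rfl
  have upd : ∀ (x : ℕ) (φ : Formula Θ) (s s' : ℕ → δ) (a : δ),
      (∀ y ∈ φ.FV \ {x}, s y = s' y) →
        ∀ y ∈ φ.FV, Function.update s x a y = Function.update s' x a y := by
    intro x φ s s' a h y hy
    by_cases hxy : y = x
    · subst hxy; simp
    · simpa [hxy] using h y ⟨hy, hxy⟩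
  induction φ generalizing w s s' with
  | rel P t =>
    have : (fun i => M.termVal w s (t i)) = fun i => M.termVal w s' (t i) :=
      funext fun i => term w s s' (t i) fun x hx => h x ⟨i, hx⟩
    simp only [Sat, this]
  | eq t t' =>
    simp only [Sat, term w s s' t fun x hx => h x (Or.inl hx),
      term w s s' t' fun x hx => h x (Or.inr hx)]
  | bot => rfl
  | and φ ψ ih ih' =>
    exact and_congr (ih fun x hx => h x (Or.inl hx)) (ih' fun x hx => h x (Or.inr hx))
  | or φ ψ ih ih' =>
    exact or_congr (ih fun x hx => h x (Or.inl hx)) (ih' fun x hx => h x (Or.inr hx))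
  | imp φ ψ ih ih' =>
    exact forall_congr' fun v => imp_congr_right fun _ =>
      imp_congr (ih fun x hx => by rw [h x (Or.inl hx)]) (ih' fun x hx => by rw [h x (Or.inr hx)])
  | all x φ ih =>
    exact forall_congr' fun v => imp_congr_right fun _ => forall₂_congr fun a _ =>
      ih (upd x φ _ _ a fun y hy => by rw [h y hy])
  | ex x φ ih =>
    exact exists_congr fun a => and_congr_right fun _ => ih (upd x φ _ _ a h)

/-- `Models` quantifies over all assignments into the domain. A sentence is insensitive to the
choice, so one convenient assignment can be used instead. -/
theorem models_iff_sat (M : KripkeModel Θ α δ) {w : α} {φ : Formula Θ} (hφ : φ.FV = ∅)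
    {s : ℕ → δ} (hs : ∀ x, s x ∈ M.dom w) : M.Models w φ ↔ M.Sat w φ s :=
  ⟨fun h => h s hs, fun h s' _ => (M.sat_congr φ (by simp [hφ])).1 h⟩

theorem exists_assignment (M : KripkeModel Θ α δ) {w : α} (hw : w ∈ M.W) :
    ∃ s : ℕ → δ, ∀ x, s x ∈ M.dom w :=
  ⟨fun _ => (M.dom_nonempty hw).some, fun _ => (M.dom_nonempty hw).some_mem⟩

theorem update_mem {M : KripkeModel Θ α δ} {w : α} {s : ℕ → δ} (hs : ∀ x, s x ∈ M.dom w)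
    {a : δ} (ha : a ∈ M.dom w) (x y : ℕ) : Function.update s x a y ∈ M.dom w := by
  by_cases h : y = x
  · subst h; simpa using ha
  · simpa [h] using hs y

end KripkeModel

/-! ### Exchanging free variables and fresh constants -/

/-- Replace the variables in the domain of `σ` by fresh constants. -/
def FOTerm.close {Θ : Signature.{u}} {n : ℕ} (σ : ℕ → Option (Fin n)) :
    FOTerm Θ → FOTerm (Θ.addConsts n)
  | var x => (σ x).elim (var x) fun i => const (Sum.inr i)
  | const c => const (Sum.inl c)

/-- Replace the free variables in the domain of `σ` by fresh constants. -/
def Formula.close {Θ : Signature.{u}} {n : ℕ} :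
    Formula Θ → (ℕ → Option (Fin n)) → Formula (Θ.addConsts n)
  | rel P t, σ => rel (Θ := Θ.addConsts n) P fun i => (t i).close σ
  | eq t t', σ => eq (t.close σ) (t'.close σ)
  | bot, _ => bot
  | and φ ψ, σ => and (φ.close σ) (ψ.close σ)
  | or φ ψ, σ => or (φ.close σ) (ψ.close σ)
  | imp φ ψ, σ => imp (φ.close σ) (ψ.close σ)
  | all x φ, σ => all x (φ.close (Function.update σ x none))
  | ex x φ, σ => ex x (φ.close (Function.update σ x none))

/-- Replace the fresh constants by the variables `v_i` with `i < n`, after renaming the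
variables `v_x` to `v_{x + n}`. -/
def FOTerm.unclose {Θ : Signature.{u}} {n : ℕ} : FOTerm (Θ.addConsts n) → FOTerm Θ
  | var x => var (x + n)
  | const (Sum.inl c) => const c
  | const (Sum.inr i) => var i

/-- Replace the fresh constants by the variables `v_i` with `i < n`, after renaming the
variables `v_x` to `v_{x + n}`. -/
def Formula.unclose {Θ : Signature.{u}} {n : ℕ} : Formula (Θ.addConsts n) → Formula Θ
  | rel P t => rel (Θ := Θ) P fun i => (t i).unclose
  | eq t t' => eq t.unclose t'.unclose
  | bot => bot
  | and φ ψ => and φ.unclose ψ.unclose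
  | or φ ψ => or φ.unclose ψ.unclose
  | imp φ ψ => imp φ.unclose ψ.unclose
  | all x φ => all (x + n) φ.unclose
  | ex x φ => ex (x + n) φ.unclose

theorem FOTerm.close_eq_var {Θ : Signature.{u}} {n : ℕ} {σ : ℕ → Option (Fin n)} {t : FOTerm Θ}
    {x : ℕ} (h : t.close σ = FOTerm.var x) : t = FOTerm.var x ∧ σ x = none := by
  cases t with
  | var y =>
    cases hy : σ y with
    | none =>
      simp only [FOTerm.close, hy, Option.elim, FOTerm.var.injEq] at h
      subst h; exact ⟨rfl, hy⟩
    | some i => simp [FOTerm.close, hy] at h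
  | const c => simp [FOTerm.close] at h

/-- The use of this bound is that closing along a `σ` defined on all free variables yields a
sentence. -/
theorem Formula.FV_close {Θ : Signature.{u}} {n : ℕ} (φ : Formula Θ) (σ : ℕ → Option (Fin n)) :
    (φ.close σ).FV ⊆ {x ∈ φ.FV | σ x = none} := by
  have upd : ∀ (x : ℕ) (φ : Formula Θ) (σ : ℕ → Option (Fin n)),
      (φ.close (Function.update σ x none)).FV ⊆
        {y ∈ φ.FV | Function.update σ x none y = none} →
      (φ.close (Function.update σ x none)).FV \ {x} ⊆ {y ∈ φ.FV \ {x} | σ y = none} := by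
    rintro x φ σ h y ⟨hy, hne⟩
    obtain ⟨h1, h2⟩ := h hy
    exact ⟨⟨h1, hne⟩, by rwa [Function.update_of_ne hne] at h2⟩
  induction φ generalizing σ with
  | rel P t =>
    rintro x ⟨i, hi⟩
    exact ⟨⟨i, (FOTerm.close_eq_var hi).1⟩, (FOTerm.close_eq_var hi).2⟩
  | eq t t' =>
    rintro x (h | h)
    · exact ⟨Or.inl (FOTerm.close_eq_var h).1, (FOTerm.close_eq_var h).2⟩
    · exact ⟨Or.inr (FOTerm.close_eq_var h).1, (FOTerm.close_eq_var h).2⟩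
  | bot => exact fun x hx => hx.elim
  | and φ ψ ih ih' | or φ ψ ih ih' | imp φ ψ ih ih' =>
    rintro x (h | h)
    · exact ⟨Or.inl (ih σ h).1, (ih σ h).2⟩
    · exact ⟨Or.inr (ih' σ h).1, (ih' σ h).2⟩
  | all x φ ih | ex x φ ih => exact upd x φ σ (ih _)

theorem Formula.eqFree_close {Θ : Signature.{u}} {n : ℕ} {φ : Formula Θ} (h : φ.EqFree)
    (σ : ℕ → Option (Fin n)) : (φ.close σ).EqFree := by
  induction φ generalizing σ with
  | rel | bot => trivial
  | eq => exact h
  | and φ ψ ih ih' | or φ ψ ih ih' | imp φ ψ ih ih' => exact ⟨ih h.1 σ, ih' h.2 σ⟩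
  | all x φ ih | ex x φ ih => exact ih h _

theorem Formula.eqFree_unclose {Θ : Signature.{u}} {n : ℕ} {φ : Formula (Θ.addConsts n)}
    (h : φ.EqFree) : φ.unclose.EqFree := by
  induction φ with
  | rel | bot => trivial
  | eq => exact h
  | and φ ψ ih ih' | or φ ψ ih ih' | imp φ ψ ih ih' => exact ⟨ih h.1, ih' h.2⟩
  | all x φ ih | ex x φ ih => exact ih h

namespace KripkeModel

variable {Θ : Signature.{u}} {α δ : Type u}

theorem termVal_close (M : KripkeModel Θ α δ) {w : α} (hw : w ∈ M.W) {n : ℕ} {a : Fin n → δ}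
    (ha : ∀ i, a i ∈ M.dom w) (v : α) (σ : ℕ → Option (Fin n)) (s : ℕ → δ) (t : FOTerm Θ) :
    (M.genExpand w hw a ha).termVal v s (t.close σ) =
      M.termVal v (fun x => (σ x).elim (s x) fun i => M.map w v (a i)) t := by
  cases t with
  | var x => cases h : σ x <;> simp only [FOTerm.close, termVal, h] <;> rfl
  | const c => rfl

/-- The fresh constant `i` denotes `M.map w v (a i)` at `v`. Functoriality of the canonical maps
makes this stable under passing to later worlds, which settles `imp` and `all`. Under a quantifier,
`close` resets `σ` at the bound variable, in step with the update of the assignment. -/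
theorem sat_close (M : KripkeModel Θ α δ) {w : α} (hw : w ∈ M.W) {n : ℕ} {a : Fin n → δ}
    (ha : ∀ i, a i ∈ M.dom w) (φ : Formula Θ) {v : α} (hv : M.le w v) (σ : ℕ → Option (Fin n))
    (s : ℕ → δ) :
    (M.genExpand w hw a ha).Sat v (φ.close σ) s ↔
      M.Sat v φ (fun x => (σ x).elim (s x) fun i => M.map w v (a i)) := by
  have step : ∀ (σ : ℕ → Option (Fin n)) (s : ℕ → δ) {v u : α}, M.le w v → M.le v u →
      (fun x => (σ x).elim (M.map v u (s x)) fun i => M.map w u (a i)) =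
        fun x => M.map v u ((σ x).elim (s x) fun i => M.map w v (a i)) := by
    intro σ s v u hv hu
    funext x
    cases σ x with
    | none => rfl
    | some i => exact M.map_trans hv hu (ha i)
  have upd : ∀ (σ : ℕ → Option (Fin n)) (s : ℕ → δ) (v : α) (x : ℕ) (b : δ),
      (fun y => (Function.update σ x none y).elim (Function.update s x b y)
        fun i => M.map w v (a i)) =
        Function.update (fun y => (σ y).elim (s y) fun i => M.map w v (a i)) x b := by
    intro σ s v x b
    funext y
    by_cases h : y = x
    · subst h; simp
    · simp [h]
  induction φ generalizing v σ s with
  | rel P t =>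
    have : (fun i => (M.genExpand w hw a ha).termVal v s ((t i).close σ)) =
        fun i => M.termVal v (fun x => (σ x).elim (s x) fun i => M.map w v (a i)) (t i) :=
      funext fun i => M.termVal_close hw ha v σ s (t i)
    change M.rel v P _ ↔ M.rel v P _
    exact iff_of_eq (congrArg (M.rel v P) this)
  | eq t t' => simp only [Formula.close, Sat, termVal_close]
  | bot => rfl
  | and φ ψ ih ih' => exact and_congr (ih hv σ s) (ih' hv σ s)
  | or φ ψ ih ih' => exact or_congr (ih hv σ s) (ih' hv σ s)
  | imp φ ψ ih ih' =>
    refine forall_congr' fun u => ⟨fun h hu => ?_, fun h hu => ?_⟩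
    · have := h ⟨hv, hu⟩
      rw [propext (ih (M.le_trans hv hu) _ _), propext (ih' (M.le_trans hv hu) _ _)] at this
      rwa [← step σ s hv hu]
    · have h := h hu.2
      rw [← step σ s hv hu.2] at h
      rwa [propext (ih (M.le_trans hv hu.2) _ _), propext (ih' (M.le_trans hv hu.2) _ _)]
  | all x φ ih =>
    refine forall_congr' fun u => ⟨fun h hu b hb => ?_, fun h hu b hb => ?_⟩
    · have := h ⟨hv, hu⟩ b hb
      rw [propext (ih (M.le_trans hv hu) _ _), upd] at this
      rwa [← step σ s hv hu]
    · have h := h hu.2 b hb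
      rw [← step σ s hv hu.2] at h
      rwa [propext (ih (M.le_trans hv hu.2) _ _), upd]
  | ex x φ ih =>
    refine exists_congr fun b => and_congr_right fun _ => ?_
    rw [propext (ih hv _ _), upd]

/-- The assignment with the values `a` on the first `n` variables and `s` on the others. -/
def shiftAssign {n : ℕ} (a : Fin n → δ) (s : ℕ → δ) (x : ℕ) : δ :=
  if h : x < n then a ⟨x, h⟩ else s (x - n)

theorem shiftAssign_update {n : ℕ} (a : Fin n → δ) (s : ℕ → δ) (x : ℕ) (b : δ) :
    shiftAssign a (Function.update s x b) = Function.update (shiftAssign a s) (x + n) b := by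
  funext y
  by_cases h : y = x + n
  · subst h; simp [shiftAssign]
  · rw [Function.update_of_ne h]
    by_cases hy : y < n
    · simp [shiftAssign, hy]
    · simp only [shiftAssign, hy, dite_false]
      rw [Function.update_of_ne (by omega)]

theorem map_shiftAssign {n : ℕ} (f : δ → δ) (a : Fin n → δ) (s : ℕ → δ) :
    (fun x => f (shiftAssign a s x)) = shiftAssign (fun i => f (a i)) fun x => f (s x) := by
  funext x
  unfold shiftAssign
  split <;> rfl

theorem termVal_unclose (M : KripkeModel Θ α δ) {w : α} (hw : w ∈ M.W) {n : ℕ} {a : Fin n → δ}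
    (ha : ∀ i, a i ∈ M.dom w) (v : α) (s : ℕ → δ) (t : FOTerm (Θ.addConsts n)) :
    M.termVal v (shiftAssign (fun i => M.map w v (a i)) s) t.unclose =
      (M.genExpand w hw a ha).termVal v s t := by
  cases t with
  | var x => simp [FOTerm.unclose, termVal, shiftAssign]
  | const c =>
    cases c with
    | inl c => rfl
    | inr i => simp only [FOTerm.unclose, termVal, shiftAssign, i.2, dite_true]; rfl

/-- Shifting every variable by `n`, bound ones included, frees the first `n` variables for the
constants, so no quantifier can capture them. The rest is functoriality of the canonical maps, as
for `sat_close`. -/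
theorem sat_unclose (M : KripkeModel Θ α δ) {w : α} (hw : w ∈ M.W) {n : ℕ} {a : Fin n → δ}
    (ha : ∀ i, a i ∈ M.dom w) (φ : Formula (Θ.addConsts n)) {v : α} (hv : M.le w v)
    (s : ℕ → δ) :
    M.Sat v φ.unclose (shiftAssign (fun i => M.map w v (a i)) s) ↔
      (M.genExpand w hw a ha).Sat v φ s := by
  have step : ∀ (s : ℕ → δ) {v u : α}, M.le w v → M.le v u →
      (fun x => M.map v u (shiftAssign (fun i => M.map w v (a i)) s x)) =
        shiftAssign (fun i => M.map w u (a i)) fun x => M.map v u (s x) := by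
    intro s v u hv hu
    rw [map_shiftAssign]
    congr 1
    funext i
    exact (M.map_trans hv hu (ha i)).symm
  induction φ generalizing v s with
  | rel P t =>
    have : (fun i => M.termVal v (shiftAssign (fun i => M.map w v (a i)) s) (t i).unclose) =
        fun i => (M.genExpand w hw a ha).termVal v s (t i) :=
      funext fun i => M.termVal_unclose hw ha v s (t i)
    change M.rel v P _ ↔ M.rel v P _
    exact iff_of_eq (congrArg (M.rel v P) this)
  | eq t t' => simp only [Formula.unclose, Sat, M.termVal_unclose hw ha]
  | bot => rfl
  | and φ ψ ih ih' => exact and_congr (ih hv s) (ih' hv s)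
  | or φ ψ ih ih' => exact or_congr (ih hv s) (ih' hv s)
  | imp φ ψ ih ih' =>
    refine forall_congr' fun u => ⟨fun h hu => ?_, fun h hu => ?_⟩
    · have h := h hu.2
      rw [step s hv hu.2] at h
      rwa [propext (ih (M.le_trans hv hu.2) _), propext (ih' (M.le_trans hv hu.2) _)] at h
    · rw [step s hv hu, propext (ih (M.le_trans hv hu) _), propext (ih' (M.le_trans hv hu) _)]
      exact h ⟨hv, hu⟩
  | all x φ ih =>
    refine forall_congr' fun u => ⟨fun h hu b hb => ?_, fun h hu b hb => ?_⟩
    · have h := h hu.2 b hb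
      rwa [step s hv hu.2, ← shiftAssign_update, propext (ih (M.le_trans hv hu.2) _)] at h
    · rw [step s hv hu, ← shiftAssign_update, propext (ih (M.le_trans hv hu) _)]
      exact h ⟨hv, hu⟩ b hb
  | ex x φ ih =>
    refine exists_congr fun b => and_congr_right fun _ => ?_
    rw [← shiftAssign_update, propext (ih hv _)]

end KripkeModel

/-! ### Preservation under asimulations -/

namespace StIL

open KripkeModel

variable {L : StIL} {Θ : Signature.{u}}

/-- The atomic clause concerns sentences over constants for the tuples. By `hs` each free variable
takes its two values at one common tuple position; replacing it by the constant of that position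
gives a sentence with the same meaning in both models. -/
theorem AsimClauses.sat_of_isAtomic {α₁ δ₁ α₂ δ₂ : Type u}
    {M : KripkeModel Θ α₁ δ₁} {N : KripkeModel Θ α₂ δ₂}
    {R : (l : ℕ) → α₁ → (Fin l → δ₁) → α₂ → (Fin l → δ₂) → Prop}
    {S : (l : ℕ) → α₂ → (Fin l → δ₂) → α₁ → (Fin l → δ₁) → Prop}
    (hR : L.AsimClauses M N R S) {φ : Formula Θ}
    (hat : ∀ (l : ℕ) (σ : ℕ → Option (Fin l)), (φ.close σ).IsAtomic)
    (hL : L.HasEq ∨ φ.EqFree) {l : ℕ} {w : α₁} {a : Fin l → δ₁} {v : α₂} {b : Fin l → δ₂}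
    (h : R l w a v b) (ha : ∀ i, a i ∈ M.dom w) (hb : ∀ i, b i ∈ N.dom v)
    {s : ℕ → δ₁} {s' : ℕ → δ₂} (hs : ∀ x ∈ φ.FV, ∃ i, s x = a i ∧ s' x = b i)
    (hsat : M.Sat w φ s) : N.Sat v φ s' := by
  classical
  obtain ⟨⟨hw, -⟩, hv, -⟩ := hR.type _ _ _ _ _ h
  -- Several positions may fit when the tuples have repetitions; any of them serves.
  let σ : ℕ → Option (Fin l) := fun x =>
    if hx : ∃ i, s x = a i ∧ s' x = b i then some hx.choose else none
  have hFV : (φ.close σ).FV = ∅ := by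
    refine Set.eq_empty_of_forall_notMem fun x hx => ?_
    obtain ⟨h1, h2⟩ := φ.FV_close σ hx
    simp [σ, hs x h1] at h2
  have hsent : φ.close σ ∈ L.sentences (Θ.addConsts l) :=
    ⟨hFV, hL.imp id fun h => Formula.eqFree_close h σ⟩
  obtain ⟨r, hr⟩ := M.exists_assignment hw
  obtain ⟨r', hr'⟩ := N.exists_assignment hv
  have hσ : ∀ x ∈ φ.FV, ∃ i, σ x = some i ∧ s x = a i ∧ s' x = b i := fun x hx =>
    ⟨(hs x hx).choose, by simp [σ, hs x hx], (hs x hx).choose_spec⟩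
  have h1 : (M.genExpand w hw a ha).Models w (φ.close σ) := by
    rw [models_iff_sat _ hFV (s := r) hr, sat_close _ _ _ _ (M.le_refl hw)]
    refine (M.sat_congr φ fun x hx => ?_).1 hsat
    obtain ⟨i, hi, hsx, -⟩ := hσ x hx
    simp only [hi, Option.elim, M.map_refl hw (ha i), hsx]
  have h2 := hR.atom l w a v b hw ha hv hb h _ hsent (hat l σ) h1
  rw [models_iff_sat _ hFV (s := r') hr', sat_close _ _ _ _ (N.le_refl hv)] at h2
  refine (N.sat_congr φ fun x hx => ?_).1 h2
  obtain ⟨i, hi, -, hsx⟩ := hσ x hx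
  simp only [hi, Option.elim, N.map_refl hv (hb i), hsx]

/-- The matching of free variables with tuple positions survives a quantifier: the bound variable is
matched with the new last position, and the others keep theirs. -/
theorem exists_snoc_eq {δ₁ δ₂ : Type u} {φ : Formula Θ} {x l : ℕ} {a : Fin l → δ₁}
    {b : Fin l → δ₂} {s : ℕ → δ₁} {s' : ℕ → δ₂}
    (hs : ∀ y ∈ φ.FV \ {x}, ∃ i, s y = a i ∧ s' y = b i) (a' : δ₁) (b' : δ₂) :
    ∀ y ∈ φ.FV, ∃ i, Function.update s x a' y = (Fin.snoc a a' : Fin (l + 1) → δ₁) i ∧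
      Function.update s' x b' y = (Fin.snoc b b' : Fin (l + 1) → δ₂) i := by
  intro y hy
  by_cases h : y = x
  · subst h
    exact ⟨Fin.last l, by simp, by simp⟩
  · obtain ⟨i, h1, h2⟩ := hs y ⟨hy, h⟩
    exact ⟨i.castSucc, by simp [h, h1], by simp [h, h2]⟩

theorem snoc_mem {δ : Type u} {D : Set δ} {l : ℕ} {a : Fin l → δ} (ha : ∀ i, a i ∈ D) {a' : δ}
    (ha' : a' ∈ D) (i : Fin (l + 1)) : (Fin.snoc a a' : Fin (l + 1) → δ) i ∈ D := by
  refine Fin.lastCases ?_ (fun j => ?_) i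
  · simpa using ha'
  · simpa using ha j

/-- Both sets of clauses are assumed and the models are generalized, since the antecedent of an
implication is carried backwards, with the two models exchanged. The side condition `hL` keeps the
atoms in the language of the logic. -/
theorem AsimClauses.sat {α₁ δ₁ α₂ δ₂ : Type u}
    {M : KripkeModel Θ α₁ δ₁} {N : KripkeModel Θ α₂ δ₂}
    {R : (l : ℕ) → α₁ → (Fin l → δ₁) → α₂ → (Fin l → δ₂) → Prop}
    {S : (l : ℕ) → α₂ → (Fin l → δ₂) → α₁ → (Fin l → δ₁) → Prop}
    (hR : L.AsimClauses M N R S) (hS : L.AsimClauses N M S R) {φ : Formula Θ}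
    (hL : L.HasEq ∨ φ.EqFree) {l : ℕ} {w : α₁} {a : Fin l → δ₁} {v : α₂} {b : Fin l → δ₂}
    (h : R l w a v b) (ha : ∀ i, a i ∈ M.dom w) (hb : ∀ i, b i ∈ N.dom v)
    {s : ℕ → δ₁} {s' : ℕ → δ₂} (hs : ∀ x ∈ φ.FV, ∃ i, s x = a i ∧ s' x = b i)
    (hsat : M.Sat w φ s) : N.Sat v φ s' := by
  induction φ generalizing α₁ δ₁ α₂ δ₂ l with
  | rel P t => exact hR.sat_of_isAtomic (fun _ _ => by trivial) hL h ha hb hs hsat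
  | eq t t' => exact hR.sat_of_isAtomic (fun _ _ => by trivial) hL h ha hb hs hsat
  | bot => exact hsat.elim
  | and φ ψ ih ih' =>
    exact ⟨ih hR hS (hL.imp id And.left) h ha hb (fun x hx => hs x (Or.inl hx)) hsat.1,
      ih' hR hS (hL.imp id And.right) h ha hb (fun x hx => hs x (Or.inr hx)) hsat.2⟩
  | or φ ψ ih ih' =>
    exact hsat.imp (ih hR hS (hL.imp id And.left) h ha hb fun x hx => hs x (Or.inl hx))
      (ih' hR hS (hL.imp id And.right) h ha hb fun x hx => hs x (Or.inr hx))
  | imp φ ψ ih ih' =>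
    intro t hvt hφ
    have hw := (hR.type _ _ _ _ _ h).1.1
    -- The world `u` is related to `t` both ways: `h2` brings the antecedent from `t` to `u`, and
    -- `h1` brings the consequent from `u` to `t`.
    obtain ⟨u, hwu, h1, h2⟩ := hR.s_back l w a v b t hw ha hb h hvt
    have ha' := fun i => M.map_mem hwu (ha i)
    have hb' := fun i => N.map_mem hvt (hb i)
    refine ih' hR hS (hL.imp id And.right) h1 ha' hb' (fun x hx => ?_) (hsat u hwu
      (ih hS hR (hL.imp id And.left) h2 hb' ha' (fun x hx => ?_) hφ))
    · obtain ⟨i, hi, hi'⟩ := hs x (Or.inr hx)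
      exact ⟨i, by rw [hi], by rw [hi']⟩
    · obtain ⟨i, hi, hi'⟩ := hs x (Or.inl hx)
      exact ⟨i, by rw [hi'], by rw [hi]⟩
  | all x φ ih =>
    intro t hvt b' hb'
    have hw := (hR.type _ _ _ _ _ h).1.1
    -- The world and the object are matched in one move, because the universal quantifier ranges
    -- over the objects of all later worlds.
    obtain ⟨u, a', hwu, ha', h1⟩ := hR.obj_back l w a v b t b' hw ha hb h hvt hb'
    refine ih hR hS hL h1 (snoc_mem (fun i => M.map_mem hwu (ha i)) ha')
      (snoc_mem (fun i => N.map_mem hvt (hb i)) hb') (exists_snoc_eq (fun y hy => ?_) a' b')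
      (hsat u hwu a' ha')
    obtain ⟨i, hi, hi'⟩ := hs y hy
    exact ⟨i, by rw [hi], by rw [hi']⟩
  | ex x φ ih =>
    obtain ⟨a', ha', hsat⟩ := hsat
    obtain ⟨⟨hw, -⟩, hv, -⟩ := hR.type _ _ _ _ _ h
    obtain ⟨b', hb', h1⟩ := hR.obj_forth l w a v b a' hw hv ha hb h ha'
    exact ⟨b', hb', ih hR hS hL h1 (snoc_mem ha ha') (snoc_mem hb hb')
      (exists_snoc_eq hs a' b') hsat⟩

theorem preservedUnderAsimulations (L : StIL) : L.PreservedUnderAsimulations := by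
  intro Θ α₁ δ₁ α₂ δ₂ M₁ w₁ M₂ w₂ R S h₁ _ hA φ hφ hsat s' _
  obtain ⟨s, hs⟩ := M₁.exists_assignment h₁.1
  exact hA.clauses_forward.sat hA.clauses_backward hφ.2 hA.elem (fun i => i.elim0)
    (fun i => i.elim0) (by simp [hφ.1]) (hsat s hs)

end StIL

/-! ### Ultraproducts and compactness -/

namespace KripkeModel

section Ultraproduct

open Filter

variable {ι : Type u}

/-- The class of a family in an ultraproduct. -/
def ultraMk (U : Ultrafilter ι) {β : ι → Type u} (f : ∀ i, β i) : (U : Filter ι).Product β :=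
  Quotient.mk (productSetoid (U : Filter ι) β) f

theorem ultraMk_eq {U : Ultrafilter ι} {β : ι → Type u} {f g : ∀ i, β i} :
    ultraMk U f = ultraMk U g ↔ ∀ᶠ i in U, f i = g i :=
  Quotient.eq (r := productSetoid (U : Filter ι) β)

/-- A family representing an element of an ultraproduct. -/
noncomputable def ultraOut {U : Ultrafilter ι} {β : ι → Type u}
    (q : (U : Filter ι).Product β) : ∀ i, β i :=
  Quotient.out q

theorem ultraMk_out {U : Ultrafilter ι} {β : ι → Type u} (q : (U : Filter ι).Product β) :
    ultraMk U (ultraOut q) = q :=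
  Quotient.out_eq q

theorem ultraOut_mk {U : Ultrafilter ι} {β : ι → Type u} (f : ∀ i, β i) :
    ∀ᶠ i in U, ultraOut (ultraMk U f) i = f i :=
  ultraMk_eq.1 (ultraMk_out _)

/-- Turns a quantifier over classes into one over families, the form produced when `skolem` moves an
existential quantifier out of an "eventually". -/
theorem ultra_exists_mk {U : Ultrafilter ι} {β : ι → Type u} {p : (U : Filter ι).Product β → Prop} :
    (∃ q, p q) ↔ ∃ f, p (ultraMk U f) :=
  ⟨fun ⟨q, h⟩ => ⟨ultraOut q, by rwa [ultraMk_out]⟩, fun ⟨f, h⟩ => ⟨_, h⟩⟩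

variable {Θ : Signature.{u}} {α δ : ι → Type u}

/-- The ultraproduct of a family of Kripke models. -/
noncomputable def ultraproduct (U : Ultrafilter ι) (M : ∀ i, KripkeModel Θ (α i) (δ i)) :
    KripkeModel Θ ((U : Filter ι).Product α) ((U : Filter ι).Product δ) where
  W := {w | ∀ᶠ i in U, ultraOut w i ∈ (M i).W}
  W_nonempty := ⟨ultraMk U fun i => (M i).W_nonempty.some, by
    filter_upwards [ultraOut_mk (U := U) fun i => (M i).W_nonempty.some] with i hi
    rw [hi]
    exact (M i).W_nonempty.some_mem⟩
  le w v := ∀ᶠ i in U, (M i).le (ultraOut w i) (ultraOut v i)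
  le_mem h := ⟨h.mono fun i hi => ((M i).le_mem hi).1, h.mono fun i hi => ((M i).le_mem hi).2⟩
  le_refl h := h.mono fun i hi => (M i).le_refl hi
  le_trans h h' := by
    filter_upwards [h, h'] with i hi hi' using (M i).le_trans hi hi'
  le_antisymm {w v} h h' := by
    rw [← ultraMk_out w, ← ultraMk_out v, ultraMk_eq]
    filter_upwards [h, h'] with i hi hi' using (M i).le_antisymm hi hi'
  dom w := {a | ∀ᶠ i in U, ultraOut a i ∈ (M i).dom (ultraOut w i)}
  dom_nonempty {w} hw := by
    -- A family needs a value at every index, so where the component of `w` is not a world an object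
    -- of an arbitrary world serves as default; such indices are negligible.
    have h : ∀ i, ∃ a, ultraOut w i ∈ (M i).W → a ∈ (M i).dom (ultraOut w i) := fun i => by
      by_cases hi : ultraOut w i ∈ (M i).W
      · exact ((M i).dom_nonempty hi).imp fun a ha _ => ha
      · exact ⟨((M i).dom_nonempty (M i).W_nonempty.some_mem).some, fun h => (hi h).elim⟩
    choose f hf using h
    refine ⟨ultraMk U f, ?_⟩
    filter_upwards [hw, ultraOut_mk (U := U) f] with i hi hfi
    rw [hfi]
    exact hf i hi
  dom_disjoint {w v} hw hv hne := by
    rw [Set.disjoint_left]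
    intro a ha ha'
    refine hne ?_
    rw [← ultraMk_out w, ← ultraMk_out v, ultraMk_eq]
    filter_upwards [hw, hv, ha, ha'] with i h1 h2 h3 h4
    by_contra h
    exact Set.disjoint_left.1 ((M i).dom_disjoint h1 h2 h) h3 h4
  rel w P a := ∀ᶠ i in U, (M i).rel (ultraOut w i) P fun k => ultraOut (a k) i
  rel_mem {w P a} hw h k := by
    filter_upwards [hw, h] with i hi hi' using (M i).rel_mem hi hi' k
  const w c := ultraMk U fun i => (M i).const (ultraOut w i) c
  const_mem {w} hw c := by
    filter_upwards [hw, ultraOut_mk (U := U) fun i => (M i).const (ultraOut w i) c] with i hi hi'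
    rw [hi']
    exact (M i).const_mem hi c
  map w v a := ultraMk U fun i => (M i).map (ultraOut w i) (ultraOut v i) (ultraOut a i)
  map_mem {w v a} h ha := by
    filter_upwards [h, ha, ultraOut_mk (U := U) fun i =>
      (M i).map (ultraOut w i) (ultraOut v i) (ultraOut a i)] with i h1 h2 h3
    rw [h3]
    exact (M i).map_mem h1 h2
  map_rel {w v P a} h h' := by
    -- Arities are finite, so the equations for all arguments hold together on one set of the
    -- ultrafilter.
    have h3 : ∀ᶠ i in U, ∀ k, ultraOut (ultraMk U fun i =>
        (M i).map (ultraOut w i) (ultraOut v i) (ultraOut (a k) i)) i =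
          (M i).map (ultraOut w i) (ultraOut v i) (ultraOut (a k) i) :=
      eventually_all.2 fun k => ultraOut_mk _
    filter_upwards [h, h', h3] with i h1 h2 h3
    simp only [h3]
    exact (M i).map_rel h1 h2
  map_const {w v} h c := by
    refine ultraMk_eq.2 ?_
    filter_upwards [h, ultraOut_mk (U := U) fun i => (M i).const (ultraOut w i) c] with i h1 h2
    rw [h2, (M i).map_const h1]
  map_refl {w a} hw ha := by
    conv_rhs => rw [← ultraMk_out a]
    refine ultraMk_eq.2 ?_
    filter_upwards [hw, ha] with i h1 h2 using (M i).map_refl h1 h2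
  map_trans {w v u a} h h' ha := by
    refine ultraMk_eq.2 ?_
    filter_upwards [h, h', ha, ultraOut_mk (U := U) fun i =>
      (M i).map (ultraOut w i) (ultraOut v i) (ultraOut a i)] with i h1 h2 h3 h4
    rw [h4, (M i).map_trans h1 h2 h3]

variable {U : Ultrafilter ι} {M : ∀ i, KripkeModel Θ (α i) (δ i)}

/-- This and the next lemmas restate the components of the ultraproduct for arbitrary representing
families instead of the chosen `ultraOut`. -/
theorem ultraproduct_mem_W {w : ∀ i, α i} :
    ultraMk U w ∈ (ultraproduct U M).W ↔ ∀ᶠ i in U, w i ∈ (M i).W := by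
  refine eventually_congr ?_
  filter_upwards [ultraOut_mk (U := U) w] with i h
  rw [h]

theorem ultraproduct_le {w v : ∀ i, α i} :
    (ultraproduct U M).le (ultraMk U w) (ultraMk U v) ↔ ∀ᶠ i in U, (M i).le (w i) (v i) := by
  refine eventually_congr ?_
  filter_upwards [ultraOut_mk (U := U) w, ultraOut_mk (U := U) v] with i h h'
  rw [h, h']

theorem ultraproduct_mem_dom {w : ∀ i, α i} {a : ∀ i, δ i} :
    ultraMk U a ∈ (ultraproduct U M).dom (ultraMk U w) ↔ ∀ᶠ i in U, a i ∈ (M i).dom (w i) := by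
  refine eventually_congr ?_
  filter_upwards [ultraOut_mk (U := U) w, ultraOut_mk (U := U) a] with i h h'
  rw [h, h']

theorem ultraproduct_rel {w : ∀ i, α i} {P : Θ.Pred} {a : Fin (Θ.arity P) → ∀ i, δ i} :
    (ultraproduct U M).rel (ultraMk U w) P (fun k => ultraMk U (a k)) ↔
      ∀ᶠ i in U, (M i).rel (w i) P fun k => a k i := by
  refine eventually_congr ?_
  filter_upwards [ultraOut_mk (U := U) w, eventually_all.2 fun k => ultraOut_mk (U := U) (a k)]
    with i h h'
  rw [h]
  simp only [h']

theorem ultraproduct_const {w : ∀ i, α i} {c : Θ.Const} :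
    (ultraproduct U M).const (ultraMk U w) c = ultraMk U fun i => (M i).const (w i) c := by
  refine ultraMk_eq.2 ?_
  filter_upwards [ultraOut_mk (U := U) w] with i h
  rw [h]

theorem ultraproduct_map {w v : ∀ i, α i} {a : ∀ i, δ i} :
    (ultraproduct U M).map (ultraMk U w) (ultraMk U v) (ultraMk U a) =
      ultraMk U fun i => (M i).map (w i) (v i) (a i) := by
  refine ultraMk_eq.2 ?_
  filter_upwards [ultraOut_mk (U := U) w, ultraOut_mk (U := U) v, ultraOut_mk (U := U) a]
    with i h h' h''
  rw [h, h', h'']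

theorem ultraproduct_termVal {w : ∀ i, α i} {s : ℕ → ∀ i, δ i} (t : FOTerm Θ) :
    (ultraproduct U M).termVal (ultraMk U w) (fun x => ultraMk U (s x)) t =
      ultraMk U fun i => (M i).termVal (w i) (fun x => s x i) t := by
  cases t with
  | var x => rfl
  | const c => exact ultraproduct_const

theorem update_ultraMk (s : ℕ → ∀ i, δ i) (x : ℕ) (a : ∀ i, δ i) :
    Function.update (fun y => ultraMk U (s y)) x (ultraMk U a) =
      fun y => ultraMk U (Function.update s x a y) := by
  funext y
  by_cases h : y = x
  · subst h; simp
  · simp [h]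

theorem update_apply_family (s : ℕ → ∀ i, δ i) (x : ℕ) (a : ∀ i, δ i) (i : ι) :
    (fun y => Function.update s x a y i) = Function.update (fun y => s y i) x (a i) := by
  funext y
  by_cases h : y = x
  · subst h; simp
  · simp [h]

/-- Łoś's theorem for Kripke models. -/
theorem ultraproduct_sat (φ : Formula Θ) {w : ∀ i, α i} {s : ℕ → ∀ i, δ i} :
    (ultraproduct U M).Sat (ultraMk U w) φ (fun x => ultraMk U (s x)) ↔
      ∀ᶠ i in U, (M i).Sat (w i) φ fun x => s x i := by
  -- Inhabited components are what `skolem` needs to choose a full family from choices at almost all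
  -- indices.
  have hα : ∀ i, Nonempty (α i) := fun i => ⟨(M i).W_nonempty.some⟩
  have hδ : ∀ i, Nonempty (δ i) := fun i =>
    ⟨((M i).dom_nonempty (M i).W_nonempty.some_mem).some⟩
  induction φ generalizing w s with
  | rel P t =>
    simp only [Sat, ultraproduct_termVal]
    exact ultraproduct_rel
  | eq t t' =>
    simp only [Sat, ultraproduct_termVal]
    exact ultraMk_eq
  | bot => exact ⟨False.elim, fun h => h.exists.elim fun _ => id⟩
  | and φ ψ ih ih' => simp only [Sat, ih, ih', eventually_and]
  | or φ ψ ih ih' => simp only [Sat, ih, ih', Ultrafilter.eventually_or]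
  | imp φ ψ ih ih' =>
    -- Negated, the quantifier over later worlds becomes existential, and a counterexample world can
    -- be chosen componentwise. Negation passes through the ultrafilter.
    rw [← not_iff_not, ← Ultrafilter.eventually_not]
    simp only [Sat, not_forall, exists_prop]
    rw [skolem, ultra_exists_mk]
    simp only [ultraproduct_le, ultraproduct_map, ih, ih', ← Ultrafilter.eventually_not,
      eventually_and]
  | all x φ ih =>
    rw [← not_iff_not, ← Ultrafilter.eventually_not]
    simp only [Sat, not_forall, exists_prop]
    rw [skolem, ultra_exists_mk]
    -- The counterexample consists of a world and an object, so a second choice of a family follows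
    -- for the object.
    refine exists_congr fun v => ?_
    rw [eventually_and, ultraproduct_le, skolem, ultra_exists_mk]
    simp only [ultraproduct_mem_dom, ultraproduct_map, update_ultraMk, ih, update_apply_family,
      ← Ultrafilter.eventually_not, eventually_and]
  | ex x φ ih =>
    simp only [Sat]
    rw [skolem, ultra_exists_mk]
    simp only [ultraproduct_mem_dom, update_ultraMk, ih, update_apply_family, eventually_and]

theorem ultraproduct_models {φ : Formula Θ} (hφ : φ.FV = ∅) {w : ∀ i, α i}
    (hw : ∀ i, w i ∈ (M i).W) :
    (ultraproduct U M).Models (ultraMk U w) φ ↔ ∀ᶠ i in U, (M i).Models (w i) φ := by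
  choose r hr using fun i => (M i).exists_assignment (hw i)
  rw [models_iff_sat (ultraproduct U M) hφ (s := fun x => ultraMk U fun i => r i x)
    fun x => ultraproduct_mem_dom.2 (Eventually.of_forall fun i => hr i x), ultraproduct_sat]
  exact eventually_congr (Eventually.of_forall fun i => ((M i).models_iff_sat hφ (hr i)).symm)

/-! ### Injective and surjective canonical maps in ultraproducts -/

theorem Inj.ultraproduct (h : ∀ i, (M i).Inj) : (ultraproduct U M).Inj := by
  intro w v hwv a ha b hb hab
  rw [← ultraMk_out a, ← ultraMk_out b, ultraMk_eq]
  filter_upwards [hwv, ha, hb, ultraMk_eq.1 hab] with i h1 h2 h3 h4 using h i _ _ h1 h2 h3 h4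

theorem Surj.ultraproduct (h : ∀ i, (M i).Surj) : (ultraproduct U M).Surj := by
  intro w v hwv b hb
  have hδ : ∀ i, Nonempty (δ i) := fun i => ⟨ultraOut b i⟩
  have : ∀ᶠ i in U, ∃ a, a ∈ (M i).dom (ultraOut w i) ∧
      (M i).map (ultraOut w i) (ultraOut v i) a = ultraOut b i := by
    filter_upwards [hwv, hb] with i h1 h2 using h i _ _ h1 h2
  obtain ⟨f, hf⟩ := skolem.1 this
  refine ⟨ultraMk U f, ?_, ?_⟩
  · rw [← ultraMk_out w, ultraproduct_mem_dom]
    exact hf.mono fun i hi => hi.1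
  · rw [← ultraMk_out w, ← ultraMk_out v, ← ultraMk_out b, ultraproduct_map, ultraMk_eq]
    exact hf.mono fun i hi => hi.2

end Ultraproduct

end KripkeModel

/-! ### Compactness -/

namespace StIL

open KripkeModel Filter

theorem Admits.ultraproduct {L : StIL} {ι : Type u} {Θ : Signature.{u}} {α δ : ι → Type u}
    {U : Ultrafilter ι} {M : ∀ i, KripkeModel Θ (α i) (δ i)} (h : ∀ i, L.Admits (M i)) :
    L.Admits (KripkeModel.ultraproduct U M) := by
  cases L with
  | IL | ILeq => trivial
  | Ineq => exact Inj.ultraproduct h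
  | CD | CDeq => exact Surj.ultraproduct h
  | Bieq => exact ⟨Inj.ultraproduct fun i => (h i).1, Surj.ultraproduct fun i => (h i).2⟩

theorem starCompact (L : StIL) : L.StarCompact := by
  classical
  intro Θ Γ Δ hΓ hΔ hfin
  -- Models are indexed by finite sets of formulas; the one at `F` handles the members of `Γ` and
  -- `Δ` that lie in `F`.
  have h : ∀ F : Finset (Formula Θ), L.PairSatisfiable (Γ ∩ F) (Δ ∩ F) := fun F =>
    hfin _ Set.inter_subset_left (F.finite_toSet.subset Set.inter_subset_right)
      _ Set.inter_subset_left (F.finite_toSet.subset Set.inter_subset_right)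
  choose α δ M w hstr hpos hneg using h
  -- An ultrafilter finer than `atTop` contains every cone above a singleton, so each formula lies
  -- in almost every index.
  let U : Ultrafilter (Finset (Formula Θ)) := Ultrafilter.of atTop
  have hU : ∀ φ : Formula Θ, ∀ᶠ F : Finset (Formula Θ) in U, φ ∈ F := fun φ =>
    Ultrafilter.of_le atTop ((eventually_ge_atTop {φ}).mono fun F hF =>
      Finset.singleton_subset_iff.1 hF)
  have hw := fun F => (hstr F).1
  refine ⟨_, _, KripkeModel.ultraproduct U M, ultraMk U w,
    ⟨ultraproduct_mem_W.2 (Eventually.of_forall hw), Admits.ultraproduct fun F => (hstr F).2⟩,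
    fun φ hφ => ?_, fun φ hφ => ?_⟩
  · rw [ultraproduct_models (hΓ hφ).1 hw]
    exact (hU φ).mono fun F hF => hpos F φ ⟨hφ, hF⟩
  · rw [ultraproduct_models (hΔ hφ).1 hw, ← Ultrafilter.eventually_not]
    exact (hU φ).mono fun F hF => hneg F φ ⟨hφ, hF⟩

end StIL

/-! ### Unions of elementary chains -/

namespace StIL

open KripkeModel

variable {L : StIL} {Θ : Signature.{u}} {α δ : Type u}

/-- A formula has only finitely many free variables, all below some `n`. Closing the variables below
`n` by constants for their values turns satisfaction into membership in a type of an `n`-tuple. -/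
theorem ElemSub.sat_iff {M N : KripkeModel Θ α δ} (h : L.ElemSub M N) {φ : Formula Θ}
    (hφ : L.HasEq ∨ φ.EqFree) {w : α} (hw : w ∈ M.W) {s : ℕ → δ} (hs : ∀ x, s x ∈ M.dom w) :
    M.Sat w φ s ↔ N.Sat w φ s := by
  obtain ⟨n, hn⟩ := φ.exists_FV_lt
  let σ : ℕ → Option (Fin n) := fun x => if hx : x < n then some ⟨x, hx⟩ else none
  have hFV : (φ.close σ).FV = ∅ := by
    refine Set.eq_empty_of_forall_notMem fun x hx => ?_
    obtain ⟨h1, h2⟩ := φ.FV_close σ hx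
    simp [σ, hn x h1] at h2
  have key : ∀ (K : KripkeModel Θ α δ) (hw : w ∈ K.W) (hs : ∀ x, s x ∈ K.dom w),
      K.Sat w φ s ↔ φ.close σ ∈ (L.Tp K w hw (fun i : Fin n => s i) fun i => hs i).1 := by
    intro K hw hs
    have hsent : φ.close σ ∈ L.sentences (Θ.addConsts n) :=
      ⟨hFV, hφ.imp id fun h => Formula.eqFree_close h σ⟩
    have : φ.close σ ∈ (L.Tp K w hw (fun i : Fin n => s i) fun i => hs i).1 ↔
        (K.genExpand w hw (fun i : Fin n => s i) fun i => hs i).Models w (φ.close σ) :=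
      and_iff_right hsent
    rw [this, models_iff_sat _ hFV (s := s) hs, sat_close _ _ _ _ (K.le_refl hw)]
    refine K.sat_congr φ fun x hx => ?_
    simp [σ, hn x hx, K.map_refl hw (hs x)]
  rw [key M hw hs, key N (h.sub.worlds hw) fun x => h.sub.dom_subset hw (hs x),
    h.tp_eq w hw n _ fun i => hs i]

/-- The converse passage: after `unclose`, the first `n` variables carry the tuple, and any
assignment into the domain may fill the rest. -/
theorem tp_eq_of_sat_iff {M N : KripkeModel Θ α δ} (h : M.Submodel N) {w : α} (hw : w ∈ M.W)
    (hsat : ∀ φ : Formula Θ, L.HasEq ∨ φ.EqFree → ∀ s : ℕ → δ, (∀ x, s x ∈ M.dom w) →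
      (M.Sat w φ s ↔ N.Sat w φ s)) {n : ℕ} (a : Fin n → δ) (ha : ∀ i, a i ∈ M.dom w) :
    L.Tp M w hw a ha = L.Tp N w (h.worlds hw) a fun i => h.dom_subset hw (ha i) := by
  obtain ⟨s, hs⟩ := M.exists_assignment hw
  have key : ∀ φ ∈ L.sentences (Θ.addConsts n), (M.genExpand w hw a ha).Models w φ ↔
      (N.genExpand w (h.worlds hw) a fun i => h.dom_subset hw (ha i)).Models w φ := by
    intro φ hφ
    rw [models_iff_sat _ hφ.1 (s := s) hs,
      models_iff_sat _ hφ.1 (s := s) fun x => h.dom_subset hw (hs x),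
      ← sat_unclose _ _ _ _ (M.le_refl hw), ← sat_unclose _ _ _ _ (N.le_refl (h.worlds hw))]
    have hm : ∀ i, M.map w w (a i) = a i := fun i => M.map_refl hw (ha i)
    have hm' : ∀ i, N.map w w (a i) = a i := fun i =>
      N.map_refl (h.worlds hw) (h.dom_subset hw (ha i))
    simp only [hm, hm']
    refine hsat _ (hφ.2.imp id Formula.eqFree_unclose) _ fun x => ?_
    unfold shiftAssign
    split
    · exact ha _
    · exact hs _
  refine Prod.ext (Set.ext fun φ => ?_) (Set.ext fun φ => ?_)
  · exact and_congr_right fun hφ => key φ hφ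
  · exact and_congr_right fun hφ => not_congr (key φ hφ)

theorem submodel_chainUnion {M : ℕ → KripkeModel Θ α δ}
    (hM : ∀ n, (M n).Submodel (M (n + 1))) (n : ℕ) : (M n).Submodel (chainUnion M hM) where
  worlds _ hw := ⟨n, hw⟩
  le_iff hw hv := ⟨fun h => ⟨n, h⟩, fun ⟨k, h⟩ =>
    ((chain_le hM (le_max_left n k)).le_iff hw hv).2
      ((chain_le hM (le_max_right n k)).le_of_le h)⟩
  dom_subset hw _ ha := ⟨n, hw, ha⟩
  rel_iff hw ha := ⟨fun h => ⟨n, hw, h⟩, fun ⟨k, hk, h⟩ =>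
    ((chain_le hM (le_max_left n k)).rel_iff hw ha).2
      (((chain_le hM (le_max_right n k)).rel_iff hk ((M k).rel_mem hk h)).1 h)⟩
  const_eq hw c := (chainConst_eq hM hw c).symm
  map_eq h ha := (chainMap_eq hM h ha).symm

/-- Each instance of injectivity or surjectivity involves finitely many worlds and objects, so it
can be checked at a stage containing them; a preimage found there also lies in the union. -/
theorem Admits.chainUnion {M : ℕ → KripkeModel Θ α δ} (hM : ∀ n, (M n).Submodel (M (n + 1)))
    (h : ∀ n, L.Admits (M n)) : L.Admits (KripkeModel.chainUnion M hM) := by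
  have inj : (∀ n, (M n).Inj) → (KripkeModel.chainUnion M hM).Inj := by
    rintro h w v ⟨m, hwv⟩ a ⟨k, hk, ha⟩ b ⟨l, hl, hb⟩ hab
    set N := max (max m k) l with hN
    have h1 := (chain_le hM (show m ≤ N by omega)).le_of_le hwv
    have h2 := (chain_le hM (show k ≤ N by omega)).dom_subset hk ha
    have h3 := (chain_le hM (show l ≤ N by omega)).dom_subset hl hb
    refine h N w v h1 h2 h3 ?_
    rw [← chainMap_eq hM h1 h2, ← chainMap_eq hM h1 h3]
    exact hab
  have surj : (∀ n, (M n).Surj) → (KripkeModel.chainUnion M hM).Surj := by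
    rintro h w v ⟨m, hwv⟩ b ⟨k, hk, hb⟩
    have h1 := (chain_le hM (le_max_left m k)).le_of_le hwv
    have h2 := (chain_le hM (le_max_right m k)).dom_subset hk hb
    obtain ⟨a, ha, hab⟩ := h _ w v h1 h2
    exact ⟨a, ⟨_, ((M _).le_mem h1).1, ha⟩, (chainMap_eq hM h1 ha).trans hab⟩
  cases L with
  | IL | ILeq => trivial
  | Ineq => exact inj h
  | CD | CDeq => exact surj h
  | Bieq => exact ⟨inj fun n => (h n).1, surj fun n => (h n).2⟩

theorem sat_chain_iff {M : ℕ → KripkeModel Θ α δ} (hM : ∀ n, L.ElemSub (M n) (M (n + 1)))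
    {φ : Formula Θ} (hφ : L.HasEq ∨ φ.EqFree) {m n : ℕ} (hmn : m ≤ n) {w : α} (hw : w ∈ (M m).W)
    {s : ℕ → δ} (hs : ∀ x, s x ∈ (M m).dom w) : (M m).Sat w φ s ↔ (M n).Sat w φ s := by
  induction hmn with
  | refl => rfl
  | @step k hk ih =>
    have hsub := chain_le (fun n => (hM n).sub) hk
    exact ih.trans ((hM k).sat_iff hφ (hsub.worlds hw) fun x => hsub.dom_subset hw (hs x))

theorem sat_chainUnion_iff {M : ℕ → KripkeModel Θ α δ} (hM : ∀ n, L.ElemSub (M n) (M (n + 1)))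
    {φ : Formula Θ} (hφ : L.HasEq ∨ φ.EqFree) {n : ℕ} {w : α} (hw : w ∈ (M n).W)
    {s : ℕ → δ} (hs : ∀ x, s x ∈ (M n).dom w) :
    (M n).Sat w φ s ↔ (chainUnion M fun k => (hM k).sub).Sat w φ s := by
  have hS := fun k => (hM k).sub
  have hU := submodel_chainUnion hS
  have map_eq : ∀ {n : ℕ} {w v : α} {s : ℕ → δ}, (M n).le w v → (∀ x, s x ∈ (M n).dom w) →
      (fun x => (chainUnion M hS).map w v (s x)) = fun x => (M n).map w v (s x) :=
    fun h hs => funext fun x => ((hU _).map_eq h (hs x)).symm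
  induction φ generalizing n w s with
  | rel P t =>
    have ht : ∀ i, (M n).termVal w s (t i) = (chainUnion M hS).termVal w s (t i) := fun i => by
      cases t i with
      | var x => rfl
      | const c => exact (hU n).const_eq hw c
    have hmem : ∀ i, (M n).termVal w s (t i) ∈ (M n).dom w := fun i => by
      cases t i with
      | var x => exact hs x
      | const c => exact (M n).const_mem hw c
    simp only [Sat, ← ht]
    exact (hU n).rel_iff hw hmem
  | eq t t' =>
    have ht : ∀ t, (M n).termVal w s t = (chainUnion M hS).termVal w s t := fun t => by
      cases t with
      | var x => rfl
      | const c => exact (hU n).const_eq hw c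
    simp only [Sat, ← ht]
  | bot => rfl
  | and φ ψ ih ih' =>
    exact and_congr (ih (hφ.imp id And.left) hw hs) (ih' (hφ.imp id And.right) hw hs)
  | or φ ψ ih ih' =>
    exact or_congr (ih (hφ.imp id And.left) hw hs) (ih' (hφ.imp id And.right) hw hs)
  | imp φ ψ ih ih' =>
    have key : ∀ {n : ℕ} {w v : α} {s : ℕ → δ}, (M n).le w v → (∀ x, s x ∈ (M n).dom w) →
        (((M n).Sat v φ (fun x => (M n).map w v (s x)) →
          (M n).Sat v ψ (fun x => (M n).map w v (s x))) ↔
        ((chainUnion M hS).Sat v φ (fun x => (chainUnion M hS).map w v (s x)) →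
          (chainUnion M hS).Sat v ψ (fun x => (chainUnion M hS).map w v (s x)))) := by
      intro n w v s h hs
      have hv := ((M n).le_mem h).2
      have hs' := fun x => (M n).map_mem h (hs x)
      rw [map_eq h hs, propext (ih (hφ.imp id And.left) hv hs'),
        propext (ih' (hφ.imp id And.right) hv hs')]
    constructor
    · rintro h v ⟨k, hk⟩
      have hsub := chain_le hS (le_max_left n k)
      have hle := (chain_le hS (le_max_right n k)).le_of_le hk
      -- The world `v` may be missing at stage `n`. The whole implication is therefore first moved
      -- up to a stage with `w ≺ v`, and only there evaluated at `v`.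
      have h' := (sat_chain_iff hM hφ (le_max_left n k) hw hs).1 h v hle
      exact (key hle fun x => hsub.dom_subset hw (hs x)).1 h'
    · exact fun h v hv => (key hv hs).2 (h v ⟨n, hv⟩)
  | all x φ ih =>
    have key : ∀ {n : ℕ} {w v : α} {s : ℕ → δ} {a : δ}, (M n).le w v → (∀ x, s x ∈ (M n).dom w) →
        a ∈ (M n).dom v →
        ((M n).Sat v φ (Function.update (fun y => (M n).map w v (s y)) x a) ↔
        (chainUnion M hS).Sat v φ
          (Function.update (fun y => (chainUnion M hS).map w v (s y)) x a)) := by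
      intro n w v s a h hs ha
      rw [map_eq h hs]
      exact ih hφ ((M n).le_mem h).2 (update_mem (fun y => (M n).map_mem h (hs y)) ha x)
    constructor
    · rintro h v ⟨k, hk⟩ a ⟨l, hl, ha⟩
      set N := max (max n k) l with hN
      have hn : n ≤ N := by omega
      have hle := (chain_le hS (show k ≤ N by omega)).le_of_le hk
      have ha' := (chain_le hS (show l ≤ N by omega)).dom_subset hl ha
      exact (key hle (fun y => (chain_le hS hn).dom_subset hw (hs y)) ha').1
        ((sat_chain_iff hM hφ hn hw hs).1 h v hle a ha')
    · exact fun h v hv a ha =>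
        (key hv hs ha).2 (h v ⟨n, hv⟩ a ⟨n, ((M n).le_mem hv).2, ha⟩)
  | ex x φ ih =>
    constructor
    · rintro ⟨a, ha, h⟩
      exact ⟨a, ⟨n, hw, ha⟩, (ih hφ hw (update_mem hs ha x)).1 h⟩
    · rintro ⟨a, ⟨k, hk, ha⟩, h⟩
      have hsub := chain_le hS (le_max_left n k)
      have ha' := (chain_le hS (le_max_right n k)).dom_subset hk ha
      have hs' := fun y => hsub.dom_subset hw (hs y)
      -- The witness may appear only at a later stage. The existential formula holds there, and
      -- elementarity returns it to stage `n`, possibly with another witness.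
      exact (sat_chain_iff hM hφ (le_max_left n k) hw hs).2
        ⟨a, ha', (ih hφ (hsub.worlds hw) (update_mem hs' ha' x)).2 h⟩

theorem tarskiUnionProperty (L : StIL) : L.TarskiUnionProperty := by
  intro Θ α δ M hM n
  have hsub := submodel_chainUnion (fun k => (hM k).sub) n
  exact ⟨(hM n).admits_left, Admits.chainUnion _ fun k => (hM k).admits_left, hsub,
    fun w hw m a ha => tp_eq_of_sat_iff hsub hw
      (fun φ hφ s hs => sat_chainUnion_iff hM hφ hw hs) a ha⟩

end StIL

theorem lemma4p1 (L : StIL) :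
    StIL.PreservedUnderAsimulations.{u} L ∧ StIL.StarCompact.{u} L ∧
      StIL.TarskiUnionProperty.{u} L :=
  ⟨L.preservedUnderAsimulations, L.starCompact, L.tarskiUnionProperty⟩
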